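/- For $n\ge 1$ and a simple graph $G$ on the vertex set $[n]$, let $U_G$ be the upper triangle of its adjacency matrix over $\mathbb F_2$ and let $$|G\rangle = 2^{-n/2}\sum_{x\in\mathbb F_2^n}(-1)^{x^{T}U_Gx}\,|x\rangle$$ be the corresponding $n$-qubit graph state. For an $n$-qubit state $|\psi\rangle$ let $$E_g(|\psi\rangle) = -\log_2\Big(\max_{\alpha\in\mathrm{PROD}_n}|\langle\alpha|\psi\rangle|^2\Big),$$ where $\mathrm{PROD}_n$ is the set of product states $\alpha_1\otimes\cdots\otimes\alpha_n$ of unit vectors $\alpha_i\in\mathbb C^2$, be its geometric entanglement. **Theorem (geometric entanglement upper bound for graph states).** Let $G$ be chosen uniformly at random among all $2^{n(n-1)/2}$ simple graphs on $[n]$. 1. There exist constants $c>0$ and $C<1$ such that for every $n\ge 2$, $$\mathbb P\Big[E_g(|G\rangle)\ \ge\ n-\frac{c\,n^{1/4}}{\log_2 n}\Big]\ \le\ C.$$ 2. There exists a constant $c'>0$ such that for every $n\ge 2$, $$\mathbb E\big[E_g(|G\rangle)\big]\ \le\ n-\frac{c'\,n^{1/4}}{\log_2 n},$$ that is, $\mathbb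 E[E_g(|G\rangle)]\le n-\Omega(n^{1/4}/\log n)$. -/

import Mathlib

open MeasureTheory ProbabilityTheory

noncomputable section

/-- State vectors of `n` qubits: the space `(ℂ²)^{⊗ n} ≅ ℂ^(𝔽₂ⁿ)`, with coordinates in the
computational basis `|x⟩`, `x ∈ 𝔽₂ⁿ`. -/
abbrev QubitSpace (n : ℕ) : Type := EuclideanSpace ℂ (Fin n → ZMod 2)

/-- The tensor product `α₁ ⊗ ⋯ ⊗ αₙ` of single-qubit vectors, in the computational basis. -/
def tensorVec {n : ℕ} (α : Fin n → EuclideanSpace ℂ (ZMod 2)) : QubitSpace n :=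
  WithLp.toLp 2 fun x => ∏ i, α i (x i)

/-- The set of (normalized) product states of `n` qubits. -/
def productStates (n : ℕ) : Set (QubitSpace n) :=
  {ψ | ∃ α : Fin n → EuclideanSpace ℂ (ZMod 2), (∀ i, ‖α i‖ = 1) ∧ ψ = tensorVec α}

/-- The maximal squared overlap of `ψ` with a product state. The supremum is a maximum, see
`isGreatest_maxProductOverlap`. -/
def maxProductOverlap {n : ℕ} (ψ : QubitSpace n) : ℝ :=
  sSup ((fun α => ‖inner ℂ α ψ‖ ^ 2) '' productStates n)

theorem isGreatest_maxProductOverlap {n : ℕ} (ψ : QubitSpace n) :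
    IsGreatest ((fun α => ‖inner ℂ α ψ‖ ^ 2) '' productStates n) (maxProductOverlap ψ) := by
  have hK : IsCompact (Set.univ.pi fun _ : Fin n =>
      Metric.sphere (0 : EuclideanSpace ℂ (ZMod 2)) 1) :=
    isCompact_univ_pi fun _ => isCompact_sphere _ _
  have hc : Continuous (tensorVec (n := n)) := by
    unfold tensorVec
    fun_prop
  have hP : productStates n = tensorVec '' (Set.univ.pi fun _ : Fin n =>
      Metric.sphere (0 : EuclideanSpace ℂ (ZMod 2)) 1) := by
    ext φ
    simp [productStates, eq_comm]
  refine IsCompact.isGreatest_sSup ?_ ?_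
  · rw [hP]
    exact (hK.image hc).image (by fun_prop)
  · refine Set.Nonempty.image _ ⟨tensorVec fun _ => EuclideanSpace.single 0 1, _, ?_, rfl⟩
    simp

/-- The geometric entanglement `E_g(ψ) = -log₂ max_α |⟨α|ψ⟩|²`, `α` ranging over product states. -/
def geometricEntanglement {n : ℕ} (ψ : QubitSpace n) : ℝ :=
  -Real.logb 2 (maxProductOverlap ψ)

open Classical in
/-- The upper triangle `U_G` of the adjacency matrix of `G`, over `𝔽₂`. -/
def upperAdj {n : ℕ} (G : SimpleGraph (Fin n)) : Matrix (Fin n) (Fin n) (ZMod 2) :=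
  Matrix.of fun i j => if i < j then G.adjMatrix (ZMod 2) i j else 0

/-- The graph state `|G⟩ = 2^{-n/2} ∑ₓ (-1)^{xᵀ U_G x} |x⟩`. -/
def graphState {n : ℕ} (G : SimpleGraph (Fin n)) : QubitSpace n :=
  WithLp.toLp 2 fun x =>
    ((1 / Real.sqrt (2 ^ n) : ℝ) : ℂ) * (-1) ^ (x ⬝ᵥ Matrix.mulVec (upperAdj G) x).val

/-- The uniform probability measure on the `2^{n(n-1)/2}` graphs with vertex set `Fin n`. -/
def uniformGraph (n : ℕ) : Measure (SimpleGraph (Fin n)) := uniformOn Set.univ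

end

/-! A principal submatrix of corank at least `k` in the adjacency matrix forces a product state of
squared overlap at least `2^(k-n)`. Put `|0⟩` outside the chosen vertices and `(|0⟩ ± |1⟩)/√2` on
them: the overlap becomes a quadratic Gauss sum, whose square is `2^s` times the size of the radical
once the signs make the quadratic form vanish on the radical (`exists_le_sq_sum_zmodSign`,
`two_pow_le_maxProductOverlap`). So it suffices that at least half of all graphs have such a
submatrix with `k` of order `√n`, which is more than the `n^(1/4)/log n` required.

Such submatrices are found by the second moment method. Take `s = 16k²` disjoint blocks of `2^16`
vertices, let `f` choose one vertex per block, and count pairs `(f, u)` where `u` is an `s × k`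
matrix annihilated by the submatrix on `f`. Each `u` imposes at most `sk` linear conditions and
about `2^(sk)` matrices `u` are allowed, so the expected count is at least half the number of
choices `f`.

For the variance, `u` is restricted to generators of codes of minimum distance greater than `2k²`.
If `f` and `g` agree in at most `2k²` places, no nonzero codeword is supported on the agreement set,
and the two events are exactly independent (`annihilating_sup_eq_top`). The remaining pairs are a
fraction at most `2^(-16k²)`, while their contribution is controlled by the moment bound `2^(8k²)`
on the number of kernel tuples (`sum_card_annihilating_le`). Cauchy–Schwarz then gives probability
at least `1/2` (`card_alternating_le_two_mul`). -/

/-- The alternating (symmetric with zero diagonal) matrices over `𝔽₂`. -/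
def alternatingMatrices (V : Type*) : Submodule (ZMod 2) (Matrix V V (ZMod 2)) where
  carrier := {A | A.transpose = A ∧ ∀ i, A i i = 0}
  zero_mem' := by simp
  add_mem' := by
    rintro A B ⟨hA, hA'⟩ ⟨hB, hB'⟩
    exact ⟨by rw [Matrix.transpose_add, hA, hB], fun i => by simp [hA', hB']⟩
  smul_mem' := by
    rintro c A ⟨hA, hA'⟩
    exact ⟨by rw [Matrix.transpose_smul, hA], fun i => by simp [hA']⟩

/-! ### Alternating matrices and independence of annihilation conditions. -/

section Alternating

variable {V σ κ : Type*}

/-- Off-diagonal terms cancel in transposed pairs in characteristic 2, and diagonal terms vanish. -/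
theorem dotProduct_mulVec_self_of_mem_alternating [Fintype σ] {A : Matrix σ σ (ZMod 2)}
    (hA : A ∈ alternatingMatrices σ) (w : σ → ZMod 2) : w ⬝ᵥ A.mulVec w = 0 := by
  have h : w ⬝ᵥ A.mulVec w = ∑ p : σ × σ, w p.1 * (A p.1 p.2 * w p.2) := by
    simp [dotProduct, Matrix.mulVec, Fintype.sum_prod_type, Finset.mul_sum]
  rw [h]
  refine Finset.sum_involution (fun p _ => (p.2, p.1)) ?_ ?_ (by simp) (by simp)
  · rintro ⟨x, y⟩ -
    have hs : A y x = A x y := congrFun (congrFun hA.1 x) y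
    simp only [hs]
    rw [show w y * (A x y * w x) = w x * (A x y * w y) by ring]
    exact CharTwo.add_self_eq_zero _
  · rintro ⟨x, y⟩ - hne heq
    obtain rfl : y = x := congrArg Prod.fst heq
    exact hne (by simp [hA.2])

theorem conj_mem_alternating [Fintype σ] {A : Matrix σ σ (ZMod 2)} (hA : A ∈ alternatingMatrices σ)
    (Q : Matrix σ V (ZMod 2)) : Q.transpose * A * Q ∈ alternatingMatrices V := by
  refine ⟨?_, fun i => ?_⟩
  · rw [Matrix.transpose_mul, Matrix.transpose_mul, hA.1, Matrix.transpose_transpose,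
      Matrix.mul_assoc]
  · rw [Matrix.mul_assoc, ← dotProduct_mulVec_self_of_mem_alternating hA (Q.transpose i)]
    rfl

theorem submatrix_mem_alternating {A : Matrix V V (ZMod 2)} (hA : A ∈ alternatingMatrices V)
    (φ : σ → V) : A.submatrix φ φ ∈ alternatingMatrices σ :=
  ⟨by rw [Matrix.transpose_submatrix, hA.1], fun i => hA.2 _⟩

/-- The alternating matrices on `V` whose restriction along `φ` annihilates the columns of `u`. -/
def annihilating [Fintype σ] (φ : σ → V) (u : Matrix σ κ (ZMod 2)) :
    Submodule (ZMod 2) (alternatingMatrices V) where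
  carrier := {A | A.1.submatrix φ φ * u = 0}
  zero_mem' := by simp
  add_mem' := by
    intro A B hA hB
    simp only [Set.mem_ofPred_eq] at hA hB ⊢
    rw [Submodule.coe_add, Matrix.submatrix_add, Pi.add_apply, Pi.add_apply, Matrix.add_mul, hA, hB,
      add_zero]
  smul_mem' := by
    intro c A hA
    simp only [Set.mem_ofPred_eq] at hA ⊢
    rw [Submodule.coe_smul, Matrix.submatrix_smul, Pi.smul_apply, Pi.smul_apply, Matrix.smul_mul,
      hA, smul_zero]

theorem mem_annihilating [Fintype σ] {φ : σ → V} {u : Matrix σ κ (ZMod 2)} {A : alternatingMatrices V} :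
    A ∈ annihilating φ u ↔ A.1.submatrix φ φ * u = 0 := Iff.rfl

open Classical in
/-- The incidence matrix of a map. -/
noncomputable def incidence (φ : σ → V) : Matrix σ V (ZMod 2) := Matrix.of fun i v => if φ i = v then 1 else 0

theorem submatrix_conj_incidence [Fintype σ] {τ : Type*} (φ : σ → V) (ψ : τ → V) (D : Matrix σ σ (ZMod 2)) :
    ((incidence φ).transpose * D * incidence φ).submatrix ψ ψ =
      ((incidence φ).submatrix id ψ).transpose * D * (incidence φ).submatrix id ψ := by
  ext i j
  simp [Matrix.mul_apply]

theorem incidence_submatrix_self [DecidableEq σ] {φ : σ → V} (hφ : Function.Injective φ) :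
    (incidence φ).submatrix id φ = 1 := by
  ext i j
  simp [incidence, Matrix.one_apply, hφ.eq_iff]

/-- A matrix fixing the coordinates in `I` and killing the columns of `u`, if no nonzero
combination of these columns is supported on `I`. -/
theorem exists_matrix_fix_kill [Fintype σ] [DecidableEq σ] [Fintype κ] (I : Set σ) (u : Matrix σ κ (ZMod 2))
    (hu : ∀ y, (∀ j, j ∉ I → u.mulVec y j = 0) → y = 0) :
    ∃ P : Matrix σ σ (ZMod 2), P * u = 0 ∧ ∀ i ∈ I, P.mulVec (Pi.single i 1) = Pi.single i 1 := by
  let p : Submodule (ZMod 2) (σ → ZMod 2) :=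
    { carrier := {x | ∀ j, j ∉ I → x j = 0}
      zero_mem' := by simp
      add_mem' := fun {a b} ha hb j hj => by simp [ha j hj, hb j hj]
      smul_mem' := fun c a ha j hj => by simp [ha j hj] }
  have hd : Disjoint p (LinearMap.range u.mulVecLin) := by
    rw [Submodule.disjoint_def]
    rintro _ hx ⟨y, rfl⟩
    have : y = 0 := hu y hx
    simp [this]
  obtain ⟨q, hq, hpq⟩ := hd.exists_isCompl
  refine ⟨LinearMap.toMatrix' (q.projection _ hpq), ?_, fun i hi => ?_⟩
  · classical
    ext i a
    have : u.mulVecLin (Pi.single a 1) ∈ LinearMap.range u.mulVecLin := ⟨_, rfl⟩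
    have h0 := (Submodule.projection_apply_eq_zero_iff hpq).2 this
    rw [← LinearMap.toMatrix'_mulVec (q.projection _ hpq)] at h0
    have h1 := congrFun h0 i
    simpa [Matrix.mul_apply, Matrix.mulVec, dotProduct, Pi.single_apply] using h1
  · rw [LinearMap.toMatrix'_mulVec]
    refine q.projection_apply_left hpq ⟨Pi.single i 1, hq fun j hj => ?_⟩
    rw [Pi.single_eq_of_ne]
    rintro rfl
    exact hj hi

/-- The cardinality of a finite `𝔽₂`-space in terms of its dimension. -/
theorem natCard_zmodTwo (M : Type*) [AddCommGroup M] [Module (ZMod 2) M] [Finite M] :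
    Nat.card M = 2 ^ Module.finrank (ZMod 2) M := by
  rw [Module.natCard_eq_pow_finrank (K := ZMod 2), Nat.card_zmod]

theorem conj_apply_of_fix [Fintype σ] [DecidableEq σ] {I : Set σ} {P A : Matrix σ σ (ZMod 2)}
    (hP : ∀ i ∈ I, P.mulVec (Pi.single i 1) = Pi.single i 1) {i j : σ} (hi : i ∈ I) (hj : j ∈ I) :
    (P.transpose * A * P) i j = A i j := by
  have hc : ∀ i ∈ I, ∀ x, P x i = (1 : Matrix σ σ (ZMod 2)) x i := fun i hi x => by
    have := congrFun (hP i hi) x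
    simpa [Matrix.one_apply, Pi.single_apply] using this
  simp [Matrix.mul_apply, hc i hi, hc j hj, Matrix.one_apply]

/-- Spanning everything is the linear form of independence of the two conditions. With `P` killing
`u` and fixing the coordinates where `φ` and `ψ` agree, `D = A_φ - Pᵀ A_φ P` vanishes on the
agreement block. Extended by zero off the range of `φ`, it is invisible through `ψ`; subtracting it
from `A` leaves `Pᵀ A_φ P` along `φ`, which kills `u`. -/
theorem annihilating_sup_eq_top [Fintype σ] [Fintype κ] {φ ψ : σ → V} (hφ : Function.Injective φ)
    (hφψ : ∀ i j, φ i = ψ j → i = j) (u u' : Matrix σ κ (ZMod 2))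
    (hu : ∀ y, (∀ j, φ j ≠ ψ j → u.mulVec y j = 0) → y = 0) :
    annihilating φ u ⊔ annihilating ψ u' = ⊤ := by
  classical
  rw [eq_top_iff]
  rintro ⟨A, hA⟩ -
  obtain ⟨P, hPu, hP⟩ := exists_matrix_fix_kill {i | φ i = ψ i} u hu
  have hAφ := submatrix_mem_alternating hA φ
  set D := A.submatrix φ φ - P.transpose * A.submatrix φ φ * P with hD
  have hDalt : D ∈ alternatingMatrices σ := sub_mem hAφ (conj_mem_alternating hAφ P)
  let C : alternatingMatrices V := ⟨_, conj_mem_alternating hDalt (incidence φ)⟩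
  have hCφ : C.1.submatrix φ φ = D := by
    simp [C, submatrix_conj_incidence, incidence_submatrix_self hφ]
  have hCψ : C.1.submatrix ψ ψ = 0 := by
    ext i j
    simp only [C, submatrix_conj_incidence, Matrix.zero_apply]
    have key : ∀ a b : σ, (incidence φ).submatrix id ψ a i * D a b *
        (incidence φ).submatrix id ψ b j = 0 := by
      intro a b
      -- Only entries of `D` with both indices in the agreement set reach the restriction along `ψ`,
      -- and there `P` acts as the identity.
      by_cases ha : φ a = ψ i
      · by_cases hb : φ b = ψ j
        · obtain rfl := hφψ _ _ ha
          obtain rfl := hφψ _ _ hb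
          simp [hD, conj_apply_of_fix (I := {i | φ i = ψ i}) hP ha hb]
        · simp [incidence, hb]
      · simp [incidence, ha]
    simp only [Matrix.mul_apply, Matrix.transpose_apply, Finset.sum_mul]
    exact Finset.sum_eq_zero fun b _ => Finset.sum_eq_zero fun a _ => key a b
  refine Submodule.mem_sup.2 ⟨⟨A, hA⟩ - C, ?_, C, ?_, by simp⟩
  · rw [mem_annihilating]
    have : (A - C.1).submatrix φ φ = P.transpose * A.submatrix φ φ * P := by
      rw [Matrix.submatrix_sub, Pi.sub_apply, Pi.sub_apply, hCφ, hD, sub_sub_cancel]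
    rw [AddSubgroupClass.coe_sub, this, Matrix.mul_assoc, hPu, Matrix.mul_zero]
  · rw [mem_annihilating, hCψ, Matrix.zero_mul]

/-- The dimension formula, read as independence of the events `K` and `L` under the uniform measure.
-/
theorem card_inf_mul_card_of_sup_eq_top {M : Type*} [AddCommGroup M] [Module (ZMod 2) M] [Finite M]
    {K L : Submodule (ZMod 2) M} (h : K ⊔ L = ⊤) :
    Nat.card ↥(K ⊓ L) * Nat.card M = Nat.card K * Nat.card L := by
  have := Submodule.finrank_sup_add_finrank_inf_eq K L
  rw [h, finrank_top] at this
  rw [natCard_zmodTwo, natCard_zmodTwo, natCard_zmodTwo, natCard_zmodTwo, ← pow_add, ← pow_add,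
    add_comm, this]

/-- `sk` linear conditions cut out at least a fraction `2^(-sk)`. -/
theorem card_alternating_le_card_annihilating [Fintype σ] [Fintype κ] [Finite V] (φ : σ → V)
    (u : Matrix σ κ (ZMod 2)) :
    Nat.card (alternatingMatrices V) ≤
      2 ^ (Fintype.card σ * Fintype.card κ) * Nat.card (annihilating φ u) := by
  let L : alternatingMatrices V →ₗ[ZMod 2] Matrix σ κ (ZMod 2) :=
    { toFun := fun A => A.1.submatrix φ φ * u
      map_add' := fun A B => by
        rw [Submodule.coe_add, Matrix.submatrix_add, Pi.add_apply, Pi.add_apply, Matrix.add_mul]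
      map_smul' := fun c A => by
        rw [Submodule.coe_smul, Matrix.submatrix_smul, Pi.smul_apply, Pi.smul_apply,
          Matrix.smul_mul, RingHom.id_apply] }
  have hker : LinearMap.ker L = annihilating φ u := by ext A; rfl
  have h := L.finrank_range_add_finrank_ker
  have h2 := (LinearMap.range L).finrank_le
  rw [Module.finrank_matrix, Module.finrank_self, mul_one] at h2
  rw [hker] at h
  rw [natCard_zmodTwo, natCard_zmodTwo, ← pow_add]
  exact Nat.pow_le_pow_right (by norm_num) (by omega)

end Alternating

/-! ### Moments of the kernel size of a random alternating matrix. -/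

section Moments

variable {V σ κ : Type*}

/-- There are at most `2^(m²)` subspaces of `𝔽₂^m`. -/
theorem card_submodule_le [Fintype κ] :
    Nat.card (Submodule (ZMod 2) (κ → ZMod 2)) ≤ 2 ^ (Fintype.card κ ^ 2) := by
  classical
  have hs : Function.Surjective
      (fun P : Matrix κ κ (ZMod 2) => LinearMap.range P.mulVecLin) := by
    intro W
    obtain ⟨q, hq⟩ := W.exists_isCompl
    refine ⟨LinearMap.toMatrix' (W.projection q hq), ?_⟩
    have : (LinearMap.toMatrix' (W.projection q hq)).mulVecLin = W.projection q hq :=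
      LinearMap.ext fun x => LinearMap.toMatrix'_mulVec _ _
    simp only [this, Submodule.range_projection]
  refine (Nat.card_le_card_of_surjective _ hs).trans (le_of_eq ?_)
  rw [natCard_zmodTwo, Module.finrank_matrix, Module.finrank_self, mul_one, sq]

/-- A matrix with rows spanning an `r`-dimensional space is annihilated by at most a fraction
`2^(-r(s-r))` of the alternating matrices. -/
theorem card_annihilating_mul_le [Fintype σ] [Fintype κ] [Finite V] {φ : σ → V}
    (hφ : Function.Injective φ) (w : σ → κ → ZMod 2) {r : ℕ}
    (hr : Module.finrank (ZMod 2) (Submodule.span (ZMod 2) (Set.range w)) = r) :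
    Nat.card (annihilating φ (Matrix.of w)) * 2 ^ (r * (Fintype.card σ - r)) ≤
      Nat.card (alternatingMatrices V) := by
  classical
  obtain ⟨R, hRspan, hRind⟩ : ∃ R : Set σ, Submodule.span (ZMod 2) (w '' R) =
      Submodule.span (ZMod 2) (Set.range w) ∧ LinearIndepOn (ZMod 2) w R := by
    obtain ⟨ι, a, ha, hspan, hind⟩ := exists_linearIndependent' (ZMod 2) w
    exact ⟨Set.range a, by rw [← Set.range_comp, hspan], (linearIndepOn_range_iff ha _).2 hind⟩
  have hRcard : Fintype.card R = r := by
    rw [← hr, ← hRspan, Set.image_eq_range, finrank_span_eq_card hRind]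
  -- Here `R` indexes a basis among the rows of `w`. The `r(s-r)` entries in `R × Rᶜ` are free bits:
  -- the product with `w` has row `j ∉ R` equal to `∑ b i j • w i`, which determines `b`. Hence the
  -- translates of the annihilator by `β b` are disjoint.
  let E : (R → ↥(Rᶜ) → ZMod 2) → Matrix σ σ (ZMod 2) := fun b => Matrix.of fun i j =>
    if h : i ∈ R ∧ j ∉ R then b ⟨i, h.1⟩ ⟨j, h.2⟩ else 0
  have hE : ∀ b, E b + (E b).transpose ∈ alternatingMatrices σ := fun b =>
    ⟨by rw [Matrix.transpose_add, Matrix.transpose_transpose, add_comm],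
      fun i => CharTwo.add_self_eq_zero _⟩
  let β : (R → ↥(Rᶜ) → ZMod 2) → alternatingMatrices V := fun b =>
    ⟨_, conj_mem_alternating (hE b) (incidence φ)⟩
  have hβ : ∀ b, (β b).1.submatrix φ φ = E b + (E b).transpose := fun b => by
    simp [β, submatrix_conj_incidence, incidence_submatrix_self hφ]
  have hinj : Function.Injective
      (fun p : annihilating φ (Matrix.of w) × (R → ↥(Rᶜ) → ZMod 2) => p.1.1 + β p.2) := by
    rintro ⟨⟨A, hA⟩, b⟩ ⟨⟨A', hA'⟩, b'⟩ h
    simp only at h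
    have hb : b = b' := by
      have h1 : (β b).1.submatrix φ φ * Matrix.of w = (β b').1.submatrix φ φ * Matrix.of w := by
        have := congrArg (fun M : alternatingMatrices V => M.1.submatrix φ φ * Matrix.of w) h
        simp only [Submodule.coe_add, Matrix.submatrix_add, Pi.add_apply, Matrix.add_mul] at this
        rw [mem_annihilating] at hA hA'
        rwa [hA, hA', zero_add, zero_add] at this
      rw [hβ, hβ] at h1
      have hrow : ∀ (c : (R → ↥(Rᶜ) → ZMod 2)) (j : ↥(Rᶜ)),
          ((E c + (E c).transpose) * Matrix.of w) j = ∑ i : R, c i j • w i := by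
        intro c j
        ext a
        have hj : (j : σ) ∉ R := j.2
        simp only [Matrix.mul_apply, Matrix.add_apply, Matrix.transpose_apply, E, Matrix.of_apply,
          hj, not_false_iff, false_and, and_true, dite_false, zero_add, Finset.sum_apply,
          Pi.smul_apply, smul_eq_mul]
        rw [← Fintype.sum_subtype_add_sum_subtype (· ∈ R), add_eq_left.2]
        · exact Finset.sum_congr rfl fun i _ => by simp
        · exact Finset.sum_eq_zero fun i _ => by simp [i.2]
      ext i j
      have h2 := congrFun h1 j
      rw [hrow, hrow, ← sub_eq_zero, ← Finset.sum_sub_distrib] at h2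
      simp only [← sub_smul] at h2
      have := Fintype.linearIndependent_iff.1 hRind _ h2 i
      exact sub_eq_zero.1 this
    subst hb
    have : A = A' := add_right_cancel h
    subst this
    rfl
  have hle := Nat.card_le_card_of_injective _ hinj
  rw [Nat.card_prod, Nat.card_fun, Nat.card_fun, Nat.card_zmod, Nat.card_eq_fintype_card (α := R),
    Nat.card_eq_fintype_card (α := ↥(Rᶜ)), hRcard, Fintype.card_compl_set, hRcard, ← pow_mul,
    mul_comm (_ - r)] at hle
  exact hle

/-- The `m`-th moment of the number of kernel vectors of a random alternating matrix. -/
theorem sum_card_annihilating_le [Fintype σ] [Fintype κ] [DecidableEq σ] [DecidableEq κ]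
    [Finite V] {φ : σ → V} (hφ : Function.Injective φ) :
    ∑ w : σ → κ → ZMod 2, Nat.card (annihilating φ (Matrix.of w)) ≤
      2 ^ (2 * Fintype.card κ ^ 2) * Nat.card (alternatingMatrices V) := by
  classical
  -- Grouping by row span `W` of dimension `r`: at most `2^(rs)` matrices, each annihilated by a
  -- fraction at most `2^(-r(s-r))`, contribute `2^(r²)`. The number of subspaces `W` supplies the
  -- second factor `2^(|κ|²)`.
  have hfib : ∀ W : Submodule (ZMod 2) (κ → ZMod 2),
      ∑ w : σ → κ → ZMod 2 with Submodule.span (ZMod 2) (Set.range w) = W,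
        Nat.card (annihilating φ (Matrix.of w)) ≤
      2 ^ (Fintype.card κ ^ 2) * Nat.card (alternatingMatrices V) := by
    intro W
    set r := Module.finrank (ZMod 2) W with hr
    have hrκ : r ≤ Fintype.card κ := by
      simpa using Submodule.finrank_le W
    have hcard : (Finset.univ.filter fun w : σ → κ → ZMod 2 =>
        Submodule.span (ZMod 2) (Set.range w) = W).card ≤ 2 ^ (r * Fintype.card σ) := by
      have hc : Nat.card (σ → W) = 2 ^ (r * Fintype.card σ) := by
        rw [Nat.card_fun, natCard_zmodTwo W, Nat.card_eq_fintype_card, pow_mul]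
      rw [← hc, ← Fintype.card_coe, ← Nat.card_eq_fintype_card]
      refine Nat.card_le_card_of_injective
        (fun w i => ⟨w.1 i, ?_⟩) ?_
      · have h := (Finset.mem_filter.1 w.2).2
        exact h.le (Submodule.subset_span ⟨i, rfl⟩)
      · intro w w' h
        refine Subtype.ext (funext fun i => ?_)
        exact congrArg Subtype.val (congrFun h i)
    by_cases hrs : r ≤ Fintype.card σ
    · have hb : ∀ w ∈ (Finset.univ.filter fun w : σ → κ → ZMod 2 =>
          Submodule.span (ZMod 2) (Set.range w) = W),
          Nat.card (annihilating φ (Matrix.of w)) * 2 ^ (r * (Fintype.card σ - r)) ≤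
            Nat.card (alternatingMatrices V) := fun w hw =>
        card_annihilating_mul_le hφ w (by rw [(Finset.mem_filter.1 hw).2])
      have hsum := Finset.sum_le_card_nsmul _ _ _ hb
      rw [← Finset.sum_mul, smul_eq_mul] at hsum
      have h3 := hsum.trans (Nat.mul_le_mul_right _ hcard)
      have h4 : r * Fintype.card σ = r * r + r * (Fintype.card σ - r) := by
        rw [← mul_add]; congr 1; omega
      rw [h4, pow_add, mul_assoc, mul_comm (2 ^ (r * (_ - r))), ← mul_assoc] at h3
      refine (Nat.le_of_mul_le_mul_right h3 (by positivity)).trans ?_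
      refine Nat.mul_le_mul_right _ (Nat.pow_le_pow_right (by norm_num) ?_)
      rw [sq]; exact Nat.mul_le_mul hrκ hrκ
    -- When `s < r` the trivial bound suffices, since `rs ≤ |κ|²`.
    · have he : ∀ w ∈ (Finset.univ.filter fun w : σ → κ → ZMod 2 =>
          Submodule.span (ZMod 2) (Set.range w) = W),
          Nat.card (annihilating φ (Matrix.of w)) ≤ Nat.card (alternatingMatrices V) := fun w _ =>
        Nat.card_le_card_of_injective _ Subtype.val_injective
      have hsum := (Finset.sum_le_card_nsmul _ _ _ he).trans (Nat.mul_le_mul_right _ hcard)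
      refine hsum.trans (Nat.mul_le_mul_right _ (Nat.pow_le_pow_right (by norm_num) ?_))
      rw [sq]; exact Nat.mul_le_mul hrκ (by omega)
  have : Fintype (Submodule (ZMod 2) (κ → ZMod 2)) := Fintype.ofFinite _
  rw [← Finset.sum_fiberwise (g := fun w : σ → κ → ZMod 2 =>
    Submodule.span (ZMod 2) (Set.range w))]
  refine (Finset.sum_le_card_nsmul _ _ _ fun W _ => hfib W).trans ?_
  have hsub := card_submodule_le (κ := κ)
  rw [Nat.card_eq_fintype_card] at hsub
  rw [smul_eq_mul, Finset.card_univ, two_mul, pow_add, mul_assoc]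
  exact Nat.mul_le_mul_right _ hsub

end Moments

/-! ### The second moment method over transversals. -/

section SecondMoment

variable {V σ κ Q : Type*}

open Classical in
theorem sum_ite_mem_submodule {M : Type*} [AddCommGroup M] [Module (ZMod 2) M] [Fintype M]
    (K : Submodule (ZMod 2) M) : ∑ x : M, (if x ∈ K then 1 else 0) = Nat.card K := by
  rw [Finset.sum_boole, Nat.card_eq_fintype_card, Fintype.card_subtype]
  rfl

theorem annihilating_sumElim [Fintype σ] (φ : σ → V) (u u' : σ → κ → ZMod 2) :
    annihilating φ (Matrix.of fun i => Sum.elim (u i) (u' i)) =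
      annihilating φ (Matrix.of u) ⊓ annihilating φ (Matrix.of u') := by
  ext A
  rw [Submodule.mem_inf, mem_annihilating, mem_annihilating, mem_annihilating]
  constructor
  · intro h
    constructor
    · ext i a
      simpa [Matrix.mul_apply] using congrFun (congrFun h i) (Sum.inl a)
    · ext i a
      simpa [Matrix.mul_apply] using congrFun (congrFun h i) (Sum.inr a)
  · rintro ⟨h, h'⟩
    ext i (a | a)
    · simpa [Matrix.mul_apply] using congrFun (congrFun h i) a
    · simpa [Matrix.mul_apply] using congrFun (congrFun h' i) a

open Classical in
/-- The number of `κ`-tuples of kernel vectors of the restriction of `A` along `φ`. -/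
noncomputable def kernelTuples [Fintype σ] [DecidableEq σ] (κ : Type*) [Fintype κ] [DecidableEq κ]
    (φ : σ → V) (A : alternatingMatrices V) :
    ℕ :=
  ∑ u : σ → κ → ZMod 2, if A ∈ annihilating φ (Matrix.of u) then 1 else 0

/-- A pair of `κ`-tuples is one `κ ⊕ κ`-tuple, so the moment bound applies with exponent `2(2|κ|)² =
8|κ|²`. -/
theorem sum_kernelTuples_sq_le [Fintype σ] [Fintype κ] [DecidableEq σ] [DecidableEq κ]
    [Finite V] [Fintype (alternatingMatrices V)] {φ : σ → V}
    (hφ : Function.Injective φ) :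
    ∑ A : alternatingMatrices V, kernelTuples κ φ A ^ 2 ≤
      2 ^ (8 * Fintype.card κ ^ 2) * Nat.card (alternatingMatrices V) := by
  classical
  have h1 : ∀ A : alternatingMatrices V, kernelTuples κ φ A ^ 2 =
      ∑ w : σ → κ ⊕ κ → ZMod 2, if A ∈ annihilating φ (Matrix.of w) then 1 else 0 := by
    intro A
    let e : (σ → κ → ZMod 2) × (σ → κ → ZMod 2) ≃ (σ → κ ⊕ κ → ZMod 2) :=
      (Equiv.arrowProdEquivProdArrow σ (fun _ => κ → ZMod 2) (fun _ => κ → ZMod 2)).symm.trans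
        (Equiv.arrowCongr (Equiv.refl σ) (Equiv.sumArrowEquivProdArrow κ κ (ZMod 2)).symm)
    have he : ∀ p, e p = fun i => Sum.elim (p.1 i) (p.2 i) := fun p => rfl
    rw [← e.sum_comp, sq, kernelTuples, Fintype.sum_mul_sum, Fintype.sum_prod_type]
    refine Finset.sum_congr rfl fun u _ => Finset.sum_congr rfl fun u' _ => ?_
    rw [he, annihilating_sumElim, Submodule.mem_inf]
    by_cases h : A ∈ annihilating φ (Matrix.of u) <;> simp [h]
  simp only [h1]
  rw [Finset.sum_comm]
  simp only [sum_ite_mem_submodule]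
  refine (sum_card_annihilating_le hφ).trans (le_of_eq ?_)
  rw [Fintype.card_sum]
  ring_nf

/-- By `2xy ≤ x² + y²`; this controls pairs of transversals that agree too often to be independent.
-/
theorem sum_kernelTuples_mul_le [Fintype σ] [Fintype κ] [DecidableEq σ] [DecidableEq κ]
    [Finite V] [Fintype (alternatingMatrices V)] {φ ψ : σ → V}
    (hφ : Function.Injective φ) (hψ : Function.Injective ψ) :
    ∑ A : alternatingMatrices V, kernelTuples κ φ A * kernelTuples κ ψ A ≤
      2 ^ (8 * Fintype.card κ ^ 2) * Nat.card (alternatingMatrices V) := by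
  have h : 2 * ∑ A : alternatingMatrices V, kernelTuples κ φ A * kernelTuples κ ψ A ≤
      ∑ A : alternatingMatrices V, kernelTuples κ φ A ^ 2 +
        ∑ A : alternatingMatrices V, kernelTuples κ ψ A ^ 2 := by
    rw [Finset.mul_sum, ← Finset.sum_add_distrib]
    refine Finset.sum_le_sum fun A _ => ?_
    rw [← mul_assoc]
    exact two_mul_le_add_sq _ _
  have h1 := sum_kernelTuples_sq_le (κ := κ) hφ
  have h2 := sum_kernelTuples_sq_le (κ := κ) hψ
  omega

/-- The subset of vertices picked by `f` out of a family of blocks. -/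
def transversal (ι : σ × Q → V) (f : σ → Q) (i : σ) : V := ι (i, f i)

theorem transversal_eq_iff {ι : σ × Q → V} (hι : Function.Injective ι) {f g : σ → Q} {i j : σ} :
    transversal ι f i = transversal ι g j ↔ i = j ∧ f i = g j := by
  rw [transversal, transversal, hι.eq_iff, Prod.mk.injEq]

theorem transversal_injective {ι : σ × Q → V} (hι : Function.Injective ι) (f : σ → Q) :
    Function.Injective (transversal ι f) := fun _ _ h => ((transversal_eq_iff hι).1 h).1

/-- A codeword of weight greater than `a` cannot be supported on an agreement set of size at most
`a`, so the spanning criterion applies. -/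
theorem card_inf_annihilating_transversal [Fintype σ] [Fintype κ] [DecidableEq Q] [Finite V] {ι : σ × Q → V}
    (hι : Function.Injective ι) {a : ℕ} {u : σ → κ → ZMod 2}
    (hu : ∀ y, y ≠ 0 → a < (Finset.univ.filter fun j => (Matrix.of u).mulVec y j ≠ 0).card)
    (u' : σ → κ → ZMod 2) {f g : σ → Q}
    (hfg : (Finset.univ.filter fun i => f i = g i).card ≤ a) :
    Nat.card ↥(annihilating (transversal ι f) (Matrix.of u) ⊓
        annihilating (transversal ι g) (Matrix.of u')) * Nat.card (alternatingMatrices V) =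
      Nat.card (annihilating (transversal ι f) (Matrix.of u)) *
        Nat.card (annihilating (transversal ι g) (Matrix.of u')) := by
  refine card_inf_mul_card_of_sup_eq_top (annihilating_sup_eq_top (transversal_injective hι f)
    (fun i j h => ((transversal_eq_iff hι).1 h).1) _ _ fun y hy => ?_)
  by_contra hne
  refine (hu y hne).not_ge (le_trans (Finset.card_le_card fun j hj => ?_) hfg)
  simp only [Finset.mem_filter, Finset.mem_univ, true_and] at hj ⊢
  by_contra hfj
  exact hj (hy j fun h => hfj ((transversal_eq_iff hι).1 h).2)

/-- Second moment method: at least half of all alternating matrices have a transversal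
restriction annihilating one of the label matrices in `U`. -/
theorem card_alternating_le_two_mul [Fintype σ] [Fintype κ] [DecidableEq σ] [Fintype Q] [DecidableEq Q] [Nonempty Q]
    [Finite V] {ι : σ × Q → V}
    (hι : Function.Injective ι) (a : ℕ) (U : Finset (σ → κ → ZMod 2))
    (hU : ∀ u ∈ U, ∀ y, y ≠ 0 →
      a < (Finset.univ.filter fun j => (Matrix.of u).mulVec y j ≠ 0).card)
    (hUcard : 2 ^ (Fintype.card σ * Fintype.card κ) ≤ 2 * U.card)
    (hbad : 4 * (Finset.univ.filter fun p : (σ → Q) × (σ → Q) =>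
      a < (Finset.univ.filter fun i => p.1 i = p.2 i).card).card * 2 ^ (8 * Fintype.card κ ^ 2) ≤
        (Fintype.card Q ^ Fintype.card σ) ^ 2) :
    Nat.card (alternatingMatrices V) ≤ 2 * Nat.card {A : alternatingMatrices V //
      ∃ f, ∃ u ∈ U, A ∈ annihilating (transversal ι f) (Matrix.of u)} := by
  classical
  have : Fintype (alternatingMatrices V) := Fintype.ofFinite _
  set Ω := Nat.card (alternatingMatrices V) with hΩ
  set K : (σ → Q) → (σ → κ → ZMod 2) → Submodule (ZMod 2) (alternatingMatrices V) :=
    fun f u => annihilating (transversal ι f) (Matrix.of u) with hK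
  set N : (σ → Q) → alternatingMatrices V → ℕ :=
    fun f A => ∑ u ∈ U, if A ∈ K f u then 1 else 0 with hN
  set Y : alternatingMatrices V → ℕ := fun A => ∑ f, N f A with hY
  set G := Finset.univ.filter fun A : alternatingMatrices V => ∃ f, ∃ u ∈ U, A ∈ K f u with hG
  have hGcard : Nat.card {A : alternatingMatrices V //
      ∃ f, ∃ u ∈ U, A ∈ annihilating (transversal ι f) (Matrix.of u)} = G.card := by
    rw [Nat.card_eq_fintype_card, Fintype.card_subtype]
  set S₁ := ∑ A, Y A with hS₁
  set S₂ := ∑ A, Y A ^ 2 with hS₂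
  have hΩpos : 0 < Ω := Nat.card_pos
  have hF : 0 < Fintype.card Q ^ Fintype.card σ := pow_pos Fintype.card_pos _
  have hS₁eq : S₁ = ∑ f, ∑ u ∈ U, Nat.card (K f u) := by
    rw [hS₁, hY, Finset.sum_comm]
    refine Finset.sum_congr rfl fun f _ => ?_
    rw [hN, Finset.sum_comm]
    simp only [sum_ite_mem_submodule]
  -- First moment: each of the at least `2^(sk)/2` label matrices succeeds with probability at least
  -- `2^(-sk)`.
  have hfirst : Fintype.card Q ^ Fintype.card σ * Ω ≤ 2 * S₁ := by
    have h1 : ∀ f : σ → Q, U.card * Ω ≤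
        2 ^ (Fintype.card σ * Fintype.card κ) * ∑ u ∈ U, Nat.card (K f u) := fun f => by
      rw [Finset.mul_sum, ← smul_eq_mul]
      exact Finset.card_nsmul_le_sum _ _ _ fun u _ =>
        card_alternating_le_card_annihilating _ _
    have h2 : ∀ f : σ → Q, Ω ≤ 2 * ∑ u ∈ U, Nat.card (K f u) := fun f => by
      refine Nat.le_of_mul_le_mul_left (c := 2 ^ (Fintype.card σ * Fintype.card κ)) ?_
        (by positivity)
      calc 2 ^ (Fintype.card σ * Fintype.card κ) * Ω ≤ 2 * U.card * Ω :=
            Nat.mul_le_mul_right _ hUcard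
        _ = 2 * (U.card * Ω) := mul_assoc _ _ _
        _ ≤ 2 * (2 ^ (Fintype.card σ * Fintype.card κ) * ∑ u ∈ U, Nat.card (K f u)) :=
            Nat.mul_le_mul_left _ (h1 f)
        _ = _ := by ring
    rw [hS₁eq, Finset.mul_sum, ← Fintype.card_fun, ← Finset.card_univ, ← smul_eq_mul]
    exact Finset.card_nsmul_le_sum _ _ _ fun f _ => h2 f
  set M : (σ → Q) × (σ → Q) → ℕ := fun p => ∑ A, N p.1 A * N p.2 A with hM
  have hS₂eq : S₂ = ∑ p, M p := by
    rw [hS₂, hM, Finset.sum_comm]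
    refine Finset.sum_congr rfl fun A _ => ?_
    rw [sq, hY, Fintype.sum_mul_sum, Fintype.sum_prod_type]
  have hMeq : ∀ p, M p = ∑ u ∈ U, ∑ u' ∈ U, Nat.card ↥(K p.1 u ⊓ K p.2 u') := by
    intro p
    simp only [hM, hN, Finset.sum_mul_sum]
    rw [Finset.sum_comm]
    refine Finset.sum_congr rfl fun u _ => ?_
    rw [Finset.sum_comm]
    refine Finset.sum_congr rfl fun u' _ => ?_
    rw [← sum_ite_mem_submodule]
    refine Finset.sum_congr rfl fun A _ => ?_
    rw [Submodule.mem_inf]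
    by_cases h : A ∈ K p.1 u <;> simp [h]
  set B := Finset.univ.filter fun p : (σ → Q) × (σ → Q) =>
      a < (Finset.univ.filter fun i => p.1 i = p.2 i).card with hB
  have hgood : ∀ p, p ∉ B → M p * Ω =
      (∑ u ∈ U, Nat.card (K p.1 u)) * ∑ u ∈ U, Nat.card (K p.2 u) := by
    intro p hp
    rw [hMeq, Finset.sum_mul_sum, Finset.sum_mul]
    refine Finset.sum_congr rfl fun u hu => ?_
    rw [Finset.sum_mul]
    refine Finset.sum_congr rfl fun u' _ => ?_
    refine card_inf_annihilating_transversal hι (hU u hu) u' (not_lt.1 fun h => hp ?_)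
    simpa [hB] using h
  -- On bad pairs the restriction to `U` is dropped and all kernel tuples are counted.
  have hMbad : ∀ p, M p ≤ 2 ^ (8 * Fintype.card κ ^ 2) * Ω := by
    intro p
    refine le_trans (Finset.sum_le_sum fun A _ => ?_)
      (sum_kernelTuples_mul_le (κ := κ) (transversal_injective hι p.1)
        (transversal_injective hι p.2))
    exact Nat.mul_le_mul (Finset.sum_le_sum_of_subset (Finset.subset_univ _))
      (Finset.sum_le_sum_of_subset (Finset.subset_univ _))
  have hsecond : S₂ * Ω ≤ S₁ ^ 2 + B.card * 2 ^ (8 * Fintype.card κ ^ 2) * Ω ^ 2 := by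
    rw [hS₂eq, ← Finset.sum_add_sum_compl B, add_comm, add_mul]
    refine add_le_add ?_ ?_
    · rw [Finset.sum_mul, Finset.sum_congr rfl fun p hp => hgood p (Finset.mem_compl.1 hp)]
      rw [hS₁eq, sq, Fintype.sum_mul_sum, ← Fintype.sum_prod_type']
      exact Finset.sum_le_sum_of_subset (Finset.subset_univ _)
    · have := Finset.sum_le_card_nsmul B M _ fun p _ => hMbad p
      calc (∑ p ∈ B, M p) * Ω ≤ (B.card * (2 ^ (8 * Fintype.card κ ^ 2) * Ω)) * Ω :=
            Nat.mul_le_mul_right _ this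
        _ = _ := by ring
  have hS₁pos : 0 < S₁ := by
    have := Nat.mul_pos hF hΩpos
    omega
  have hsecond' : S₂ * Ω ≤ 2 * S₁ ^ 2 := by
    have h3 : 4 * (B.card * 2 ^ (8 * Fintype.card κ ^ 2) * Ω ^ 2) ≤ 4 * S₁ ^ 2 := by
      calc 4 * (B.card * 2 ^ (8 * Fintype.card κ ^ 2) * Ω ^ 2)
          = 4 * B.card * 2 ^ (8 * Fintype.card κ ^ 2) * Ω ^ 2 := by ring
        _ ≤ (Fintype.card Q ^ Fintype.card σ) ^ 2 * Ω ^ 2 := Nat.mul_le_mul_right _ hbad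
        _ = (Fintype.card Q ^ Fintype.card σ * Ω) ^ 2 := by ring
        _ ≤ (2 * S₁) ^ 2 := Nat.pow_le_pow_left hfirst 2
        _ = 4 * S₁ ^ 2 := by ring
    omega
  have hYzero : ∀ A, A ∉ G → Y A = 0 := by
    intro A hA
    refine Finset.sum_eq_zero fun f _ => Finset.sum_eq_zero fun u hu => if_neg fun h => hA ?_
    exact Finset.mem_filter.2 ⟨Finset.mem_univ _, f, u, hu, h⟩
  -- Cauchy–Schwarz on the support of `Y`, which lies in `G`.
  have hCS : S₁ ^ 2 ≤ G.card * S₂ := by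
    have h1 : S₁ = ∑ A ∈ G, Y A := (Finset.sum_subset (Finset.subset_univ _) fun A _ hA =>
      hYzero A hA).symm
    rw [h1]
    refine (sq_sum_le_card_mul_sum_sq (s := G) (f := Y)).trans (Nat.mul_le_mul_left _ ?_)
    exact Finset.sum_le_sum_of_subset (Finset.subset_univ _)
  rw [hGcard]
  refine Nat.le_of_mul_le_mul_left (c := S₁ ^ 2) ?_ (by positivity)
  calc S₁ ^ 2 * Ω ≤ G.card * S₂ * Ω := Nat.mul_le_mul_right _ hCS
    _ = G.card * (S₂ * Ω) := mul_assoc _ _ _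
    _ ≤ G.card * (2 * S₁ ^ 2) := Nat.mul_le_mul_left _ hsecond'
    _ = _ := by ring

end SecondMoment

/-! ### Counting agreeing choices and codes of small distance. -/

section Counting

variable {σ κ Q : Type*} [Fintype σ] [DecidableEq σ] [Fintype Q]

/-- Exponential Markov inequality for the number of coordinates of a function having a given
property. -/
theorem card_filter_le_card_mul_pow_le (P : σ → Q → Prop) [∀ i, DecidablePred (P i)]
    {t : ℕ} (ht : 1 ≤ t) {N : ℕ} (hN : ∀ i, ∑ x, (if P i x then t else 1) = N) (a : ℕ) :
    (Finset.univ.filter fun g : σ → Q =>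
      a ≤ (Finset.univ.filter fun i => P i (g i)).card).card * t ^ a ≤ N ^ Fintype.card σ := by
  have h : ∑ g : σ → Q, ∏ i, (if P i (g i) then t else 1) = N ^ Fintype.card σ := by
    rw [← Fintype.prod_sum fun i x => if P i x then t else 1]
    simp [hN]
  rw [← h, ← smul_eq_mul]
  refine le_trans (Finset.card_nsmul_le_sum _
    (fun g => ∏ i, if P i (g i) then t else 1) _ fun g hg => ?_)
    (Finset.sum_le_sum_of_subset (Finset.subset_univ _))
  rw [Finset.prod_ite, Finset.prod_const, Finset.prod_const_one, mul_one]
  exact Nat.pow_le_pow_right ht (Finset.mem_filter.1 hg).2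

/-- Exponential Markov with weight `|Q|` on agreement: each coordinate contributes `|Q| + (|Q| - 1)
≤ 2|Q|`. -/
theorem card_agree_mul_le [DecidableEq Q] (f : σ → Q) (a : ℕ) :
    (Finset.univ.filter fun g : σ → Q =>
      a < (Finset.univ.filter fun i => f i = g i).card).card * Fintype.card Q ^ a ≤
        (2 * Fintype.card Q) ^ Fintype.card σ := by
  rcases isEmpty_or_nonempty σ with hσ | ⟨⟨i₀⟩⟩
  · simp
  have hq : 1 ≤ Fintype.card Q := Fintype.card_pos_iff.2 ⟨f i₀⟩
  have hN : ∀ i, ∑ x, (if f i = x then Fintype.card Q else 1) =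
      Fintype.card Q + (Fintype.card Q - 1) := by
    intro i
    rw [Finset.sum_ite, Finset.filter_eq, Finset.filter_ne]
    simp
  have h := card_filter_le_card_mul_pow_le (fun i x => f i = x) hq hN a
  refine le_trans (Nat.mul_le_mul_right _ (Finset.card_le_card fun g hg => ?_))
    (h.trans (Nat.pow_le_pow_left (by omega) _))
  simp only [Finset.mem_filter, Finset.mem_univ, true_and] at hg ⊢
  exact hg.le

theorem card_agreeing_pairs_mul_le [DecidableEq Q] (a : ℕ) :
    (Finset.univ.filter fun p : (σ → Q) × (σ → Q) =>
      a < (Finset.univ.filter fun i => p.1 i = p.2 i).card).card * Fintype.card Q ^ a ≤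
        2 ^ Fintype.card σ * (Fintype.card Q ^ Fintype.card σ) ^ 2 := by
  rw [← Finset.univ_product_univ, Finset.card_filter, Finset.sum_product, Finset.sum_mul]
  simp only [← Finset.card_filter]
  refine (Finset.sum_le_card_nsmul _ _ _ fun f _ => card_agree_mul_le f a).trans (le_of_eq ?_)
  rw [Finset.card_univ, Fintype.card_fun, smul_eq_mul]
  ring

/-- Translating `v` by a basis vector where `y` is nonzero flips `v ⬝ᵥ y`, so both values occur
equally often. -/
theorem two_mul_sum_ite_dotProduct [Fintype κ] [DecidableEq κ] {y : κ → ZMod 2} (hy : y ≠ 0)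
    (t : ℕ) : 2 * ∑ v : κ → ZMod 2, (if v ⬝ᵥ y = 0 then t else 1) =
      (t + 1) * 2 ^ Fintype.card κ := by
  obtain ⟨a, ha⟩ : ∃ a, y a ≠ 0 := Function.ne_iff.1 hy
  have hone : ∀ c : ZMod 2, c ≠ 0 → c = 1 := by decide
  have hshift : ∀ c : ZMod 2, (if c = 0 then t else 1) + (if c + 1 = 0 then t else 1) = t + 1 := by
    have : ∀ c : ZMod 2, c = 0 ∨ c = 1 := by decide
    intro c
    rcases this c with rfl | rfl
    · simp
    · rw [show (1 + 1 : ZMod 2) = 0 by decide]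
      simp [add_comm]
  have h1 := Equiv.sum_comp (Equiv.addRight (Pi.single a (1 : ZMod 2)))
    fun v : κ → ZMod 2 => if v ⬝ᵥ y = 0 then t else 1
  rw [two_mul]
  nth_rewrite 2 [← h1]
  rw [← Finset.sum_add_distrib]
  simp only [Equiv.coe_addRight, add_dotProduct, single_dotProduct, hone _ ha, mul_one, hshift]
  simp [mul_comm]

/-- Weight at most `2k²` means at least `14k²` zeros among `16k²` fair bits. Exponential Markov with
weight 4 gives probability at most `(5/2)^(16k²) / 4^(14k²)`, and `5^16 ≤ 2^38` turns this into
`2^(-6k²)`. -/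
theorem card_light_labels_mul_le [Fintype κ] [DecidableEq κ] {y : κ → ZMod 2} (hy : y ≠ 0)
    (k : ℕ) (hσ : Fintype.card σ = 16 * k ^ 2) :
    (Finset.univ.filter fun u : σ → κ → ZMod 2 =>
      (Finset.univ.filter fun j => (Matrix.of u).mulVec y j ≠ 0).card ≤ 2 * k ^ 2).card *
        2 ^ (6 * k ^ 2) ≤ 2 ^ (Fintype.card σ * Fintype.card κ) := by
  set S := ∑ v : κ → ZMod 2, (if v ⬝ᵥ y = 0 then 4 else 1) with hS
  have hS2 : 2 * S = 5 * 2 ^ Fintype.card κ := two_mul_sum_ite_dotProduct hy 4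
  have h := card_filter_le_card_mul_pow_le (σ := σ) (fun _ (v : κ → ZMod 2) => v ⬝ᵥ y = 0)
    (t := 4) (by norm_num) (N := S) (fun _ => rfl) (14 * k ^ 2)
  set c := (Finset.univ.filter fun u : σ → κ → ZMod 2 =>
    14 * k ^ 2 ≤ (Finset.univ.filter fun i => u i ⬝ᵥ y = 0).card).card with hc
  have hle : (Finset.univ.filter fun u : σ → κ → ZMod 2 =>
      (Finset.univ.filter fun j => (Matrix.of u).mulVec y j ≠ 0).card ≤ 2 * k ^ 2).card ≤ c := by
    refine Finset.card_le_card fun u hu => ?_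
    simp only [Finset.mem_filter, Finset.mem_univ, true_and] at hu ⊢
    have h3 := Finset.card_filter_add_card_filter_not (s := (Finset.univ : Finset σ))
      (fun j => u j ⬝ᵥ y = 0)
    have h4 : (Finset.univ.filter fun j => (Matrix.of u).mulVec y j ≠ 0) =
      Finset.univ.filter fun j => ¬ u j ⬝ᵥ y = 0 := rfl
    rw [h4] at hu
    rw [Finset.card_univ, hσ] at h3
    omega
  refine (Nat.mul_le_mul_right _ hle).trans ?_
  have h5 : c * 4 ^ (14 * k ^ 2) * 2 ^ (16 * k ^ 2) ≤
      2 ^ (38 * k ^ 2) * 2 ^ (Fintype.card σ * Fintype.card κ) := by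
    calc c * 4 ^ (14 * k ^ 2) * 2 ^ (16 * k ^ 2) ≤ S ^ Fintype.card σ * 2 ^ (16 * k ^ 2) :=
          Nat.mul_le_mul_right _ h
      _ = (2 * S) ^ Fintype.card σ := by rw [← hσ, mul_pow, mul_comm]
      _ = (5 ^ 16) ^ (k ^ 2) * 2 ^ (Fintype.card σ * Fintype.card κ) := by
          rw [hS2, mul_pow, ← pow_mul 2, mul_comm (Fintype.card κ), hσ, pow_mul 5]
      _ ≤ (2 ^ 38) ^ (k ^ 2) * 2 ^ (Fintype.card σ * Fintype.card κ) :=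
          Nat.mul_le_mul_right _ (Nat.pow_le_pow_left (by norm_num) _)
      _ = _ := by rw [← pow_mul]
  refine Nat.le_of_mul_le_mul_left (c := 2 ^ (38 * k ^ 2)) (le_trans (le_of_eq ?_) h5)
    (by positivity)
  rw [show (4 : ℕ) = 2 ^ 2 by norm_num, ← pow_mul]
  have : 2 ^ (38 * k ^ 2) * (c * 2 ^ (6 * k ^ 2)) = c * (2 ^ (38 * k ^ 2) * 2 ^ (6 * k ^ 2)) := by
    ring
  rw [this, mul_assoc, ← pow_add, ← pow_add]
  ring_nf

/-- At least half of the label matrices define a code of large minimum distance. -/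
theorem card_labels_le_two_mul_card_heavy [Fintype κ] [DecidableEq κ]
    (hκ : 1 ≤ Fintype.card κ) (hσ : Fintype.card σ = 16 * Fintype.card κ ^ 2) :
    2 ^ (Fintype.card σ * Fintype.card κ) ≤ 2 * (Finset.univ.filter fun u : σ → κ → ZMod 2 =>
      ∀ y, y ≠ 0 → 2 * Fintype.card κ ^ 2 <
        (Finset.univ.filter fun j => (Matrix.of u).mulVec y j ≠ 0).card).card := by
  set k := Fintype.card κ with hk
  set D := Fintype.card σ * k with hD
  have htot : Fintype.card (σ → κ → ZMod 2) = 2 ^ D := by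
    rw [Fintype.card_fun, Fintype.card_fun, ZMod.card, ← pow_mul, mul_comm]
  set L : (κ → ZMod 2) → Finset (σ → κ → ZMod 2) := fun y =>
    Finset.univ.filter fun u : σ → κ → ZMod 2 =>
      (Finset.univ.filter fun j => (Matrix.of u).mulVec y j ≠ 0).card ≤ 2 * k ^ 2 with hL
  set H := Finset.univ.filter fun u : σ → κ → ZMod 2 => ∀ y, y ≠ 0 → 2 * k ^ 2 <
    (Finset.univ.filter fun j => (Matrix.of u).mulVec y j ≠ 0).card with hH
  have hsub : Hᶜ ⊆ (Finset.univ.filter fun y : κ → ZMod 2 => y ≠ 0).biUnion L := by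
    intro u hu
    simp only [hH, Finset.mem_compl, Finset.mem_filter, Finset.mem_univ, true_and, not_forall,
      not_lt] at hu
    obtain ⟨y, hy, h⟩ := hu
    simp only [Finset.mem_biUnion, Finset.mem_filter, Finset.mem_univ, true_and, hL]
    exact ⟨y, hy, h⟩
  have hcompl : Hᶜ.card * 2 ^ (6 * k ^ 2) ≤ 2 ^ k * 2 ^ D := by
    calc Hᶜ.card * 2 ^ (6 * k ^ 2)
        ≤ (∑ y ∈ Finset.univ.filter fun y : κ → ZMod 2 => y ≠ 0, (L y).card) * 2 ^ (6 * k ^ 2) :=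
          Nat.mul_le_mul_right _ ((Finset.card_le_card hsub).trans Finset.card_biUnion_le)
      _ ≤ (Finset.univ.filter fun y : κ → ZMod 2 => y ≠ 0).card • 2 ^ D := by
          rw [Finset.sum_mul]
          exact Finset.sum_le_card_nsmul _ _ _ fun y hy =>
            card_light_labels_mul_le (Finset.mem_filter.1 hy).2 k hσ
      _ ≤ 2 ^ k * 2 ^ D := by
          rw [smul_eq_mul]
          refine Nat.mul_le_mul_right _ ((Finset.card_le_univ _).trans (le_of_eq ?_))
          rw [Fintype.card_fun, ZMod.card]
  -- The union bound over fewer than `2^k` nonzero words costs less than the gain `2^(6k²)`, with a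
  -- factor 2 left over.
  have hexp : 2 * 2 ^ k ≤ 2 ^ (6 * k ^ 2) := by
    rw [← pow_succ']
    exact Nat.pow_le_pow_right (by norm_num) (by nlinarith)
  have hhalf : 2 * Hᶜ.card ≤ 2 ^ D := by
    refine Nat.le_of_mul_le_mul_left (c := 2 ^ k) ?_ (by positivity)
    calc 2 ^ k * (2 * Hᶜ.card) = Hᶜ.card * (2 * 2 ^ k) := by ring
      _ ≤ Hᶜ.card * 2 ^ (6 * k ^ 2) := Nat.mul_le_mul_left _ hexp
      _ ≤ _ := hcompl
  have := Finset.card_add_card_compl H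
  rw [htot] at this
  omega

end Counting

/-! ### Principal submatrices of large corank. -/

/-- At least half of the alternating matrices of size `n ≥ 2²⁰k²` have a principal submatrix of
corank at least `k`. -/
theorem card_alternating_le_two_mul_card_corank {k n : ℕ} (hk : 1 ≤ k) (hn : 2 ^ 20 * k ^ 2 ≤ n) :
    Nat.card (alternatingMatrices (Fin n)) ≤ 2 * Nat.card {A : alternatingMatrices (Fin n) //
      ∃ φ : Fin (16 * k ^ 2) → Fin n, Function.Injective φ ∧
        ∃ u : Matrix (Fin (16 * k ^ 2)) (Fin k) (ZMod 2), (∀ y, u.mulVec y = 0 → y = 0) ∧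
          A.1.submatrix φ φ * u = 0} := by
  have hcard : Fintype.card (Fin (16 * k ^ 2) × Fin (2 ^ 16)) ≤ Fintype.card (Fin n) := by
    rw [Fintype.card_prod, Fintype.card_fin, Fintype.card_fin, Fintype.card_fin]
    refine le_trans (le_of_eq ?_) hn
    rw [show 2 ^ 20 = 2 ^ 16 * 16 by norm_num]
    ring
  obtain ⟨ι⟩ := Function.Embedding.nonempty_of_card_le hcard
  have hpairs := card_agreeing_pairs_mul_le (σ := Fin (16 * k ^ 2)) (Q := Fin (2 ^ 16)) (2 * k ^ 2)
  have hheavy := card_labels_le_two_mul_card_heavy (σ := Fin (16 * k ^ 2)) (κ := Fin k)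
    (by simpa using hk) (by simp)
  simp only [Fintype.card_fin] at hpairs hheavy
  refine (card_alternating_le_two_mul (κ := Fin k) ι.injective (2 * k ^ 2) _
    (fun u hu => (Finset.mem_filter.1 hu).2) (by simpa using hheavy) ?_).trans ?_
  · simp only [Fintype.card_fin]
    -- Blocks of size `2^16` make the fraction of bad pairs at most `2^(16k²) / 2^(32k²)`; the
    -- requirement becomes `2 + 8k² + 16k² ≤ 32k²`.
    refine Nat.le_of_mul_le_mul_left (c := (2 ^ 16) ^ (2 * k ^ 2)) ?_ (by positivity)
    refine le_trans (le_of_eq (by ring)) ((Nat.mul_le_mul_right (4 * 2 ^ (8 * k ^ 2))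
      hpairs).trans ?_)
    rw [mul_right_comm]
    refine Nat.mul_le_mul_right _ ?_
    rw [show (4 : ℕ) = 2 ^ 2 by norm_num, ← pow_add, ← pow_add]
    rw [← pow_mul]
    exact Nat.pow_le_pow_right (by norm_num) (by nlinarith)
  · refine Nat.mul_le_mul_left _ (Nat.card_le_card_of_injective
      (fun A => ⟨A.1, ?_⟩) fun A B h => Subtype.ext (congrArg (fun x => x.1) h))
    obtain ⟨f, u, hu, hA⟩ := A.2
    refine ⟨_, transversal_injective ι.injective f, Matrix.of u, fun y hy => ?_, hA⟩
    by_contra hne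
    have := (Finset.mem_filter.1 hu).2 y hne
    simp [hy] at this

/-! ### Signs and quadratic Gauss sums over `𝔽₂`. -/

/-- The sign `(-1)^c` of an element of `𝔽₂`. -/
noncomputable def zmodSign (c : ZMod 2) : ℝ := (-1) ^ c.val

theorem zmodTwo_eq_zero_or_one : ∀ c : ZMod 2, c = 0 ∨ c = 1 := by decide

@[simp] theorem zmodSign_zero : zmodSign 0 = 1 := by simp [zmodSign]

theorem zmodSign_one : zmodSign 1 = -1 := by simp [zmodSign, ZMod.val_one]

theorem zmodSign_add (a b : ZMod 2) : zmodSign (a + b) = zmodSign a * zmodSign b := by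
  rcases zmodTwo_eq_zero_or_one a with rfl | rfl
  · simp
  rcases zmodTwo_eq_zero_or_one b with rfl | rfl
  · simp
  rw [show (1 + 1 : ZMod 2) = 0 by decide, zmodSign_one]
  simp

theorem zmodSign_sum {ι : Type*} (s : Finset ι) (f : ι → ZMod 2) :
    zmodSign (∑ i ∈ s, f i) = ∏ i ∈ s, zmodSign (f i) := by
  classical
  induction s using Finset.induction_on with
  | empty => simp
  | insert a s ha ih => rw [Finset.sum_insert ha, Finset.prod_insert ha, zmodSign_add, ih]

theorem abs_zmodSign (c : ZMod 2) : |zmodSign c| = 1 := by simp [zmodSign]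

section GaussSum

variable {σ κ : Type*} [Fintype σ] [DecidableEq σ]

/-- Orthogonality of characters: if `w ≠ 0`, translation by a basis vector negates the sum. -/
theorem sum_zmodSign_dotProduct (w : σ → ZMod 2) :
    ∑ x : σ → ZMod 2, zmodSign (w ⬝ᵥ x) = if w = 0 then 2 ^ Fintype.card σ else 0 := by
  split_ifs with h
  · simp [h]
  · obtain ⟨a, ha⟩ : ∃ a, w a ≠ 0 := Function.ne_iff.1 h
    have ha1 : w a = 1 := (zmodTwo_eq_zero_or_one _).resolve_left ha
    have h1 := Equiv.sum_comp (Equiv.addRight (Pi.single a (1 : ZMod 2)))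
      fun x : σ → ZMod 2 => zmodSign (w ⬝ᵥ x)
    simp only [Equiv.coe_addRight, dotProduct_add, dotProduct_single, ha1, mul_one, zmodSign_add,
      zmodSign_one, mul_neg, Finset.sum_neg_distrib] at h1
    linarith

/-- The square of a quadratic Gauss sum over `𝔽₂`, twisted so as to be trivial on the radical. -/
theorem exists_le_sq_sum_zmodSign [Fintype κ] {q : (σ → ZMod 2) → ZMod 2}
    {A : Matrix σ σ (ZMod 2)}
    (hq : ∀ x h, q (x + h) = q x + q h + A.mulVec h ⬝ᵥ x) {u : Matrix σ κ (ZMod 2)}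
    (hu : ∀ y, u.mulVec y = 0 → y = 0) (hAu : A * u = 0) :
    ∃ b : σ → ZMod 2, (2 : ℝ) ^ (Fintype.card σ + Fintype.card κ) ≤
      (∑ x : σ → ZMod 2, zmodSign (q x + b ⬝ᵥ x)) ^ 2 := by
  classical
  set H := LinearMap.ker A.mulVecLin with hH
  have hmem : ∀ h, h ∈ H ↔ A.mulVec h = 0 := fun h => by rw [hH, LinearMap.mem_ker]; rfl
  -- On the radical `H` the polar form vanishes, so `q` is additive there and extends to a linear
  -- functional `g` on the whole space. The twist `q + g` is then zero on `H`.
  let qH : H →+ ZMod 2 :=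
    { toFun := fun h => q h
      map_zero' := by
        have := hq 0 0
        simpa using this
      map_add' := fun x h => by
        rw [Submodule.coe_add, hq, (hmem _).1 h.2, zero_dotProduct, add_zero] }
  obtain ⟨g, hg⟩ := (qH.toZModLinearMap 2).exists_extend
  refine ⟨fun i => g (Pi.single i 1), ?_⟩
  have hgb : ∀ x, (fun i => g (Pi.single i 1)) ⬝ᵥ x = g x := fun x => by
    rw [LinearMap.pi_apply_eq_sum_univ g x, dotProduct]
    refine Finset.sum_congr rfl fun i _ => ?_
    rw [mul_comm, smul_eq_mul]
    congr 2
    ext j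
    simp [Pi.single_apply, eq_comm]
  have hgq : ∀ h ∈ H, g h = q h := fun h hh => by
    have := LinearMap.congr_fun hg ⟨h, hh⟩
    exact this
  simp only [hgb]
  -- Writing the second variable as `x + h`, the sum over `x` is a character sum that survives only
  -- for `h` in the radical, where the remaining sign is 1.
  have hsq : (∑ x : σ → ZMod 2, zmodSign (q x + g x)) ^ 2 =
      ∑ h : σ → ZMod 2, if A.mulVec h = 0 then 2 ^ Fintype.card σ else 0 := by
    calc (∑ x : σ → ZMod 2, zmodSign (q x + g x)) ^ 2
        = ∑ x, ∑ h, zmodSign (q x + g x) * zmodSign (q (x + h) + g (x + h)) := by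
          rw [sq, Finset.sum_mul_sum]
          refine Finset.sum_congr rfl fun x _ => ?_
          rw [← Equiv.sum_comp (Equiv.addLeft x)]
          rfl
      _ = ∑ x, ∑ h, zmodSign (q h + g h) * zmodSign (A.mulVec h ⬝ᵥ x) := by
          refine Finset.sum_congr rfl fun x _ => Finset.sum_congr rfl fun h _ => ?_
          rw [← zmodSign_add, ← zmodSign_add, hq, map_add]
          congr 1
          have h1 := CharTwo.add_self_eq_zero (q x)
          have h2 := CharTwo.add_self_eq_zero (g x)
          linear_combination h1 + h2
      _ = ∑ h, zmodSign (q h + g h) * ∑ x, zmodSign (A.mulVec h ⬝ᵥ x) := by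
          rw [Finset.sum_comm]
          simp only [Finset.mul_sum]
      _ = _ := by
          refine Finset.sum_congr rfl fun h _ => ?_
          rw [sum_zmodSign_dotProduct]
          split_ifs with hz
          · rw [hgq h ((hmem h).2 hz), CharTwo.add_self_eq_zero, zmodSign_zero, one_mul]
          · rw [mul_zero]
  rw [hsq, ← Finset.sum_filter, Finset.sum_const, nsmul_eq_mul, pow_add, mul_comm]
  refine mul_le_mul_of_nonneg_right ?_ (by positivity)
  have hinj : Function.Injective u.mulVec := by
    intro y y' h
    rw [← sub_eq_zero]
    exact hu _ (by rw [Matrix.mulVec_sub, h, sub_self])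
  have hcard : (Finset.univ : Finset (κ → ZMod 2)).card ≤
      (Finset.univ.filter fun h : σ → ZMod 2 => A.mulVec h = 0).card :=
    Finset.card_le_card_of_injOn u.mulVec
      (fun y _ => by simp [Matrix.mulVec_mulVec, hAu]) hinj.injOn
  rw [Finset.card_univ, Fintype.card_fun, ZMod.card] at hcard
  exact_mod_cast hcard

end GaussSum

/-! ### From corank to overlap with a product state. -/

section Overlap

variable {n : ℕ} {σ κ : Type*}

theorem dotProduct_extend [Fintype σ] {φ : σ → Fin n} (hφ : Function.Injective φ) (w : Fin n → ZMod 2)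
    (z : σ → ZMod 2) : w ⬝ᵥ Function.extend φ z 0 = (w ∘ φ) ⬝ᵥ z := by
  refine (Fintype.sum_of_injective φ hφ _ _ (fun v hv => ?_) fun i => ?_).symm
  · rw [Function.extend_apply' _ _ _ (by simpa using hv)]
    simp
  · rw [hφ.extend_apply]
    rfl

theorem extend_zero_add {φ : σ → Fin n} (z h : σ → ZMod 2) :
    Function.extend φ (z + h) 0 = Function.extend φ z 0 + Function.extend φ h 0 := by
  rw [← Function.extend_add, add_zero]

open Classical in
theorem upperAdj_add_transpose (G : SimpleGraph (Fin n)) :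
    upperAdj G + (upperAdj G).transpose = G.adjMatrix (ZMod 2) := by
  ext i j
  rcases lt_trichotomy i j with h | rfl | h
  · simp [upperAdj, h, h.not_gt]
  · simp [upperAdj]
  · simp [upperAdj, h, h.not_gt, G.adj_comm]

open Classical in
-- Polarization: the cross terms of `xᵀ U x` assemble into `U + Uᵀ`, the adjacency matrix.
theorem graph_quadratic_extend [Fintype σ] {φ : σ → Fin n} (hφ : Function.Injective φ)
    (G : SimpleGraph (Fin n)) (x h : σ → ZMod 2) :
    Function.extend φ (x + h) 0 ⬝ᵥ (upperAdj G).mulVec (Function.extend φ (x + h) 0) =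
      Function.extend φ x 0 ⬝ᵥ (upperAdj G).mulVec (Function.extend φ x 0) +
      Function.extend φ h 0 ⬝ᵥ (upperAdj G).mulVec (Function.extend φ h 0) +
      ((G.adjMatrix (ZMod 2)).submatrix φ φ).mulVec h ⬝ᵥ x := by
  have h1 : ((G.adjMatrix (ZMod 2)).submatrix φ φ).mulVec h ⬝ᵥ x =
      (G.adjMatrix (ZMod 2)).mulVec (Function.extend φ h 0) ⬝ᵥ Function.extend φ x 0 := by
    rw [dotProduct_extend hφ]
    congr 1
    ext i
    exact (dotProduct_extend hφ (G.adjMatrix (ZMod 2) (φ i)) h).symm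
  rw [h1, ← upperAdj_add_transpose, extend_zero_add, Matrix.add_mulVec, Matrix.mulVec_add,
    add_dotProduct, dotProduct_add, add_dotProduct, dotProduct_add]
  have h2 : (upperAdj G).transpose.mulVec (Function.extend φ h 0) ⬝ᵥ Function.extend φ x 0 =
      Function.extend φ h 0 ⬝ᵥ (upperAdj G).mulVec (Function.extend φ x 0) := by
    rw [Matrix.mulVec_transpose, Matrix.dotProduct_mulVec]
  rw [h2, dotProduct_comm ((upperAdj G).mulVec (Function.extend φ h 0))]
  ring

open Classical in
/-- The product state with `|0⟩` outside the range of `φ` and `(|0⟩ ± |1⟩)/√2` on it. -/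
noncomputable def signState (φ : σ → Fin n) (b : σ → ZMod 2) (v : Fin n) :
    EuclideanSpace ℂ (ZMod 2) :=
  if v ∈ Set.range φ then
    WithLp.toLp 2 fun c => ((zmodSign (Function.extend φ b 0 v * c) / Real.sqrt 2 : ℝ) : ℂ)
  else EuclideanSpace.single 0 1

theorem norm_signState (φ : σ → Fin n) (b : σ → ZMod 2) (v : Fin n) : ‖signState φ b v‖ = 1 := by
  unfold signState
  split_ifs
  · have h : ∀ c : ZMod 2, ‖((zmodSign (Function.extend φ b 0 v * c) / Real.sqrt 2 : ℝ) : ℂ)‖ ^ 2 =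
        1 / 2 := fun c => by
      rw [Complex.norm_real, Real.norm_eq_abs, abs_div, abs_zmodSign, div_pow,
        abs_of_nonneg (Real.sqrt_nonneg 2), Real.sq_sqrt (by norm_num), one_pow]
    rw [EuclideanSpace.norm_eq]
    simp only [h]
    simp
  · simp

theorem prod_signState_extend [Fintype σ] {φ : σ → Fin n} (hφ : Function.Injective φ) (b z : σ → ZMod 2) :
    ∏ v, signState φ b v (Function.extend φ z 0 v) =
      ((zmodSign (b ⬝ᵥ z) * (1 / Real.sqrt 2) ^ Fintype.card σ : ℝ) : ℂ) := by
  have h : ∏ i, ((zmodSign (b i * z i) / Real.sqrt 2 : ℝ) : ℂ) =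
      ∏ v, signState φ b v (Function.extend φ z 0 v) := by
    refine Fintype.prod_of_injective φ hφ _ _ (fun v hv => ?_) fun i => ?_
    · rw [Function.extend_apply' _ _ _ (by simpa using hv), signState, if_neg hv]
      simp
    · rw [signState, if_pos ⟨i, rfl⟩, hφ.extend_apply, hφ.extend_apply]
  rw [← h, dotProduct, zmodSign_sum]
  push_cast
  simp [div_eq_mul_inv, Finset.prod_mul_distrib]

/-- Such an `x` is nonzero at some vertex outside the range of `φ`, where the factor is `|0⟩`. This
reduces the overlap to a sum over `σ → ZMod 2`. -/
theorem prod_signState_eq_zero {φ : σ → Fin n} (b : σ → ZMod 2) {x : Fin n → ZMod 2}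
    (hx : x ∉ Set.range fun z : σ → ZMod 2 => Function.extend φ z 0) :
    ∏ v, signState φ b v (x v) = 0 := by
  classical
  have : ∃ v, v ∉ Set.range φ ∧ x v ≠ 0 := by
    by_contra! h
    refine hx ⟨x ∘ φ, funext fun v => ?_⟩
    by_cases hv : v ∈ Set.range φ
    · obtain ⟨i, rfl⟩ := hv
      simp only
      by_cases hi : ∃ a, φ a = φ i
      · rw [Function.extend_def, dif_pos hi, Function.comp_apply, hi.choose_spec]
      · exact absurd ⟨i, rfl⟩ hi
    · simp only
      rw [Function.extend_apply' _ _ _ (by simpa using hv), h v hv]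
      rfl
  obtain ⟨v, hv, hxv⟩ := this
  refine Finset.prod_eq_zero (Finset.mem_univ v) ?_
  rw [signState, if_neg hv]
  simp [hxv]

open Classical in
/-- A principal submatrix of corank `k` of the adjacency matrix yields a product state with
squared overlap `2^(k-n)`. -/
theorem two_pow_le_maxProductOverlap [Fintype σ] [Fintype κ] {φ : σ → Fin n} (hφ : Function.Injective φ)
    (G : SimpleGraph (Fin n)) {u : Matrix σ κ (ZMod 2)} (hu : ∀ y, u.mulVec y = 0 → y = 0)
    (hAu : (G.adjMatrix (ZMod 2)).submatrix φ φ * u = 0) :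
    (2 : ℝ) ^ Fintype.card κ / 2 ^ n ≤ maxProductOverlap (graphState G) := by
  obtain ⟨b, hb⟩ := exists_le_sq_sum_zmodSign
    (q := fun z => Function.extend φ z 0 ⬝ᵥ (upperAdj G).mulVec (Function.extend φ z 0))
    (graph_quadratic_extend hφ G) hu hAu
  set T := ∑ z : σ → ZMod 2, zmodSign (Function.extend φ z 0 ⬝ᵥ
    (upperAdj G).mulVec (Function.extend φ z 0) + b ⬝ᵥ z) with hT
  have hinner : inner ℂ (tensorVec (signState φ b)) (graphState G) =
      (((1 / Real.sqrt 2) ^ Fintype.card σ * (1 / Real.sqrt (2 ^ n)) * T : ℝ) : ℂ) := by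
    rw [PiLp.inner_apply, hT, Finset.mul_sum, Complex.ofReal_sum]
    symm
    refine Fintype.sum_of_injective (fun z : σ → ZMod 2 => Function.extend φ z 0) ?_ _ _
      (fun x hx => ?_) fun z => ?_
    · intro z z' h
      have := congrArg (fun w => w ∘ φ) h
      simpa [Function.extend_comp hφ] using this
    · simp only [tensorVec]
      rw [prod_signState_eq_zero b hx]
      simp
    · simp only [tensorVec, graphState]
      rw [prod_signState_extend hφ, zmodSign_add]
      simp only [RCLike.inner_apply, Complex.conj_ofReal]
      unfold zmodSign
      push_cast
      ring
  have hmem := (isGreatest_maxProductOverlap (graphState G)).2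
    ⟨tensorVec (signState φ b), ⟨_, norm_signState φ b, rfl⟩, rfl⟩
  refine le_trans ?_ hmem
  simp only [hinner]
  rw [Complex.norm_real, Real.norm_eq_abs, sq_abs, mul_pow, mul_pow, pow_right_comm, div_pow, div_pow _ _ 2,
    Real.sq_sqrt (by norm_num), Real.sq_sqrt (by positivity)]
  calc (2 : ℝ) ^ Fintype.card κ / 2 ^ n =
      (1 ^ 2 / 2) ^ Fintype.card σ * (1 ^ 2 / 2 ^ n) * 2 ^ (Fintype.card σ + Fintype.card κ) := by
        rw [pow_add, div_pow]
        field_simp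
        simp
    _ ≤ _ := mul_le_mul_of_nonneg_left hb (by positivity)

open Classical in
theorem geometricEntanglement_le_sub [Fintype σ] [Fintype κ] {φ : σ → Fin n} (hφ : Function.Injective φ)
    (G : SimpleGraph (Fin n)) {u : Matrix σ κ (ZMod 2)} (hu : ∀ y, u.mulVec y = 0 → y = 0)
    (hAu : (G.adjMatrix (ZMod 2)).submatrix φ φ * u = 0) :
    geometricEntanglement (graphState G) ≤ n - Fintype.card κ := by
  have h := Real.logb_le_logb_of_le (b := 2) (by norm_num) (by positivity)
    (two_pow_le_maxProductOverlap hφ G hu hAu)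
  rw [Real.logb_div (by positivity) (by positivity), Real.logb_pow, Real.logb_pow,
    Real.logb_self_eq_one (by norm_num), mul_one, mul_one] at h
  rw [geometricEntanglement]
  linarith

/-- A single vertex gives a `1 × 1` zero submatrix, of corank 1. This settles the small `n` for
which the asymptotic choice of `k` is 0. -/
theorem geometricEntanglement_le_sub_one (hn : 1 ≤ n) (G : SimpleGraph (Fin n)) :
    geometricEntanglement (graphState G) ≤ n - 1 := by
  classical
  have h := geometricEntanglement_le_sub (σ := Fin 1) (κ := Fin 1) (φ := fun _ => ⟨0, hn⟩)
    (Function.injective_of_subsingleton _) G (u := 1) (fun y hy => by simpa using hy)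
    (by ext i j; simp)
  simpa using h

end Overlap

/-! ### Random graphs: probability and expectation. -/

instance measurableSingletonClass_simpleGraph (n : ℕ) :
    MeasurableSingletonClass (SimpleGraph (Fin n)) where
  measurableSet_singleton G := by
    have h : ({G} : Set (SimpleGraph (Fin n))) =
        ⋂ u, ⋂ v, {H | H.Adj u v ↔ G.Adj u v} := by
      ext H
      simp only [Set.mem_singleton_iff, Set.mem_iInter, Set.mem_ofPred_eq]
      exact ⟨fun h u v => by rw [h], fun h => SimpleGraph.ext (by ext u v; exact h u v)⟩
    rw [h]
    refine MeasurableSet.iInter fun u => MeasurableSet.iInter fun v => ?_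
    have hm : Measurable fun H : SimpleGraph (Fin n) => H.Adj u v := by fun_prop
    exact measurableSet_setOfPred.2 (hm.iff measurable_const)

open Classical in
/-- Graphs correspond to alternating matrices over `𝔽₂` via the adjacency matrix. -/
noncomputable def graphEquivAlternating (n : ℕ) :
    SimpleGraph (Fin n) ≃ alternatingMatrices (Fin n) where
  toFun G := ⟨G.adjMatrix (ZMod 2), G.transpose_adjMatrix, fun i => by simp⟩
  invFun A := Matrix.IsAdjMatrix.toGraph (A := A.1)
    ⟨fun _ _ => zmodTwo_eq_zero_or_one _, A.2.1, A.2.2⟩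
  left_inv G := by
    ext u v
    simp [Matrix.IsAdjMatrix.toGraph]
  right_inv A := by
    ext u v
    refine (@SimpleGraph.adjMatrix_apply _ _ _ (_) u v _ _).trans ?_
    rcases zmodTwo_eq_zero_or_one (A.1 u v) with h | h <;> simp [Matrix.IsAdjMatrix.toGraph, h]

theorem card_graph_le_two_mul {k n : ℕ} (hk : 1 ≤ k) (hn : 2 ^ 20 * k ^ 2 ≤ n) :
    Nat.card (SimpleGraph (Fin n)) ≤
      2 * Nat.card {G : SimpleGraph (Fin n) // geometricEntanglement (graphState G) ≤ n - k} := by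
  classical
  rw [Nat.card_congr (graphEquivAlternating n)]
  refine (card_alternating_le_two_mul_card_corank hk hn).trans (Nat.mul_le_mul_left _ ?_)
  refine Nat.card_le_card_of_injective (fun A => ⟨(graphEquivAlternating n).symm A.1, ?_⟩)
    fun A B h => Subtype.ext ((graphEquivAlternating n).symm.injective (congrArg Subtype.val h))
  obtain ⟨φ, hφ, u, hu, hA⟩ := A.2
  have hA' : (((graphEquivAlternating n).symm A.1).adjMatrix (ZMod 2)).submatrix φ φ * u = 0 := by
    have : ((graphEquivAlternating n).symm A.1).adjMatrix (ZMod 2) = A.1.1 :=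
      congrArg Subtype.val ((graphEquivAlternating n).apply_symm_apply A.1)
    rw [this, hA]
  simpa using geometricEntanglement_le_sub hφ _ hu hA'

theorem isProbabilityMeasure_uniformGraph (n : ℕ) : IsProbabilityMeasure (uniformGraph n) :=
  instIsProbabilityMeasure_uniformOn_univ

theorem uniformGraph_real_apply (n : ℕ) (p : SimpleGraph (Fin n) → Prop) :
    (uniformGraph n).real {G | p G} = Nat.card {G // p G} / Nat.card (SimpleGraph (Fin n)) := by
  classical
  have : Fintype (SimpleGraph (Fin n)) := Fintype.ofFinite _
  rw [Measure.real, uniformGraph, uniformOn_univ, Measure.count_apply_finite _ (Set.toFinite _),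
    ENNReal.toReal_div, ENNReal.toReal_natCast, ENNReal.toReal_natCast, Nat.card_eq_fintype_card,
    Nat.card_eq_fintype_card, Fintype.card_subtype]
  congr 3
  ext
  simp

/-- With probability at least `1/2`, the geometric entanglement of a random graph state is at most
`n - Ω(√n)`. -/
theorem half_le_uniformGraph_real {n : ℕ} (hn : 1 ≤ n) : ∃ m : ℝ, Real.sqrt n / 2048 ≤ m ∧
    1 / 2 ≤ (uniformGraph n).real {G | geometricEntanglement (graphState G) ≤ n - m} := by
  -- Since `1024² = 2^20`, this `k` satisfies `2^20 k² ≤ n`. For `k ≥ 1`, `√n ≤ 1024(k + 1) ≤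
  -- 2048k`; for `k = 0`, `√n ≤ 1024` and `m = 1` works for every graph.
  set k := n.sqrt / 1024 with hk
  have hsqrt : Real.sqrt n ≤ n.sqrt + 1 := by
    exact Real.real_sqrt_le_nat_sqrt_succ
  have hk1 : n.sqrt + 1 ≤ 1024 * (k + 1) := by omega
  have hk1' : (n.sqrt : ℝ) + 1 ≤ 1024 * (k + 1) := by exact_mod_cast hk1
  rcases Nat.eq_zero_or_pos k with h0 | hpos
  · refine ⟨1, ?_, ?_⟩
    · rw [h0] at hk1'
      norm_num at hk1'
      linarith
    · have : {G : SimpleGraph (Fin n) | geometricEntanglement (graphState G) ≤ n - 1} =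
          Set.univ := Set.eq_univ_of_forall fun G => geometricEntanglement_le_sub_one hn G
      have hp := isProbabilityMeasure_uniformGraph n
      rw [this, probReal_univ]
      norm_num
  · refine ⟨k, ?_, ?_⟩
    · have : (1 : ℝ) ≤ k := by exact_mod_cast hpos
      linarith
    · have hkn : 2 ^ 20 * k ^ 2 ≤ n := by
        have h1 : 1024 * k ≤ n.sqrt := by omega
        calc 2 ^ 20 * k ^ 2 = (1024 * k) ^ 2 := by ring
          _ ≤ n.sqrt ^ 2 := Nat.pow_le_pow_left h1 2
          _ ≤ n := Nat.sqrt_le' n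
      have h := card_graph_le_two_mul hpos hkn
      have hpos' : (0 : ℝ) < Nat.card (SimpleGraph (Fin n)) := by exact_mod_cast Nat.card_pos
      rw [uniformGraph_real_apply, le_div_iff₀ hpos']
      have : (Nat.card (SimpleGraph (Fin n)) : ℝ) ≤ 2 * Nat.card {G : SimpleGraph (Fin n) //
          geometricEntanglement (graphState G) ≤ n - k} := by exact_mod_cast h
      linarith

theorem rpow_quarter_div_logb_le_sqrt {n : ℕ} (hn : 2 ≤ n) :
    (n : ℝ) ^ (1 / 4 : ℝ) / Real.logb 2 n ≤ Real.sqrt n := by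
  have hn' : (2 : ℝ) ≤ n := by exact_mod_cast hn
  have hlog : 1 ≤ Real.logb 2 n := by
    rw [Real.le_logb_iff_rpow_le (by norm_num) (by linarith), Real.rpow_one]
    exact hn'
  calc (n : ℝ) ^ (1 / 4 : ℝ) / Real.logb 2 n ≤ (n : ℝ) ^ (1 / 4 : ℝ) :=
        div_le_self (by positivity) hlog
    _ ≤ (n : ℝ) ^ (1 / 2 : ℝ) :=
        Real.rpow_le_rpow_of_exponent_le (by linarith) (by norm_num)
    _ = Real.sqrt n := (Real.sqrt_eq_rpow _).symm

/-- The entanglement is at most `n` for every graph and drops by a further `m` on an event of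
probability at least `1/2`. -/
theorem integral_geometricEntanglement_le {n : ℕ} (hn : 1 ≤ n) {m : ℝ} (hm : 0 ≤ m)
    (h : 1 / 2 ≤ (uniformGraph n).real {G | geometricEntanglement (graphState G) ≤ n - m}) :
    ∫ G, geometricEntanglement (graphState G) ∂(uniformGraph n) ≤ n - m / 2 := by
  have hp := isProbabilityMeasure_uniformGraph n
  set S := {G : SimpleGraph (Fin n) | geometricEntanglement (graphState G) ≤ n - m} with hS
  have hSm : MeasurableSet S := S.toFinite.measurableSet
  calc ∫ G, geometricEntanglement (graphState G) ∂(uniformGraph n)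
      ≤ ∫ G, ((n : ℝ) - S.indicator (fun _ => m) G) ∂(uniformGraph n) := by
        refine integral_mono Integrable.of_finite Integrable.of_finite fun G => ?_
        by_cases hG : G ∈ S
        · rw [Set.indicator_of_mem hG]
          exact hG
        · simp only [Set.indicator_of_notMem hG, sub_zero]
          linarith [geometricEntanglement_le_sub_one hn G]
    _ = n - (uniformGraph n).real S * m := by
        rw [integral_sub Integrable.of_finite Integrable.of_finite, integral_const,
          integral_indicator_const _ hSm]
        simp
    _ ≤ n - m / 2 := by nlinarith

theorem mainTheorem5 :
    (∃ c C : ℝ, 0 < c ∧ C < 1 ∧ ∀ n : ℕ, 2 ≤ n →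
      (uniformGraph n).real
        {G | geometricEntanglement (graphState G) ≥
          (n : ℝ) - c * (n : ℝ) ^ (1 / 4 : ℝ) / Real.logb 2 n} ≤ C) ∧
    (∃ c : ℝ, 0 < c ∧ ∀ n : ℕ, 2 ≤ n →
      ∫ G, geometricEntanglement (graphState G) ∂(uniformGraph n) ≤
        (n : ℝ) - c * (n : ℝ) ^ (1 / 4 : ℝ) / Real.logb 2 n) := by
  -- The constant is half of `1/2048`: in the first part this makes the two events strictly
  -- disjoint, in the second it absorbs the probability `1/2`.
  refine ⟨⟨1 / 4096, 1 / 2, by norm_num, by norm_num, fun n hn => ?_⟩,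
    ⟨1 / 4096, by norm_num, fun n hn => ?_⟩⟩
  · obtain ⟨m, hm, hprob⟩ := half_le_uniformGraph_real (n := n) (by omega)
    have hp := isProbabilityMeasure_uniformGraph n
    have hsqrt : 0 < Real.sqrt n := Real.sqrt_pos.2 (by exact_mod_cast (by omega : 0 < n))
    have hle := rpow_quarter_div_logb_le_sqrt hn
    set S := {G : SimpleGraph (Fin n) | geometricEntanglement (graphState G) ≤ n - m} with hS
    have hcompl := probReal_compl_eq_one_sub (μ := uniformGraph n) S.toFinite.measurableSet
    refine (measureReal_mono (fun G hG => ?_)).trans (b := (uniformGraph n).real Sᶜ) (by linarith)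
    intro hGS
    have h1 : geometricEntanglement (graphState G) ≤ n - m := hGS
    have h2 : (n : ℝ) - 1 / 4096 * (n : ℝ) ^ (1 / 4 : ℝ) / Real.logb 2 n ≤
      geometricEntanglement (graphState G) := hG
    rw [mul_div_assoc] at h2
    linarith
  · obtain ⟨m, hm, hprob⟩ := half_le_uniformGraph_real (n := n) (by omega)
    have hle := rpow_quarter_div_logb_le_sqrt hn
    have h := integral_geometricEntanglement_le (by omega)
      (le_trans (by positivity) hm) hprob
    rw [mul_div_assoc]
    linarith
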